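/- Let $M$ be a compact connected smooth manifold without boundary, of dimension $d\ge 0$. A function $\phi:M\to\mathbb{R}$ is called semiconcave (with linear modulus), written $\phi\in\mathrm{SCL}(M)$, if $\phi=\inf_i\phi_i$ pointwise for a family $\{\phi_i\}$ of $C^2$ functions on $M$ whose Hessians are uniformly bounded above: every point of $M$ has a neighbourhood, smooth coordinates on it and a constant $C$ such that in these coordinates $D^2\phi_i\le C\,I$ on this neighbourhood for all $i$. For $x\in M$, the (proximal) superdifferential $D^+\phi(x)\subseteq T^*_xM$ is the set of all differentials $Df(x)$ of functions $f$ that are $C^2$ near $x$ and satisfy $f(x)=\phi(x)$ and $f\ge\phi$ near $x$; it is a nonempty convex set, and $\dim D^+\phi(x)$ denotes the dimension of its affine hull. A set $E\subseteq\mathbb{R}^n$ is $m$-rectifiable ($m\geq 0$ an integer) if $E=f(B)$ for a Lipschitz map $f:\mathbb{R}^m\to\mathbb{R}^n$ and a bounded set $B\subseteq\mathbb{R}^m$; it is countably $m$-rectifiable if it is a countable union of $m$-rectifiable sets; and it is countably $(\mathcal H^m,m)$-rectifiable if there is a countably $m$-rectifiable set $A$ with $\mathcal H^m(E\setminus A)=0$,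 where $\mathcal H^m$ is the $m$-dimensional Hausdorff measure. A subset of $M$ is countably $(\mathcal H^m,m)$-rectifiable if its image in every smooth chart of $M$ is a countably $(\mathcal H^m,m)$-rectifiable subset of $\mathbb{R}^d$. **Proposition.** Let $\phi\in\mathrm{SCL}(M)$ and let $k\in\{0,1,\dots,d\}$. Then the set $$\Sigma^{\ge k}(\phi)=\{x\in M:\dim D^+\phi(x)\ge k\}$$ is countably $(\mathcal H^{d-k},d-k)$-rectifiable, and hence so is $$\Sigma^{k}(\phi)=\{x\in M:\dim D^+\phi(x)= k\}.$$ -/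

import Mathlib

open scoped Manifold ContDiff MeasureTheory NNReal Topology

namespace SCL

noncomputable section

/-! ### Rectifiability in Euclidean space -/

/-- `E ⊆ ℝⁿ` is `m`-rectifiable: the image of a bounded subset of `ℝᵐ` under a Lipschitz map
`ℝᵐ → ℝⁿ`. For `m = 0` these are the empty set and the one-point sets. -/
def IsRectifiable {n : ℕ} (m : ℕ) (E : Set (EuclideanSpace ℝ (Fin n))) : Prop :=
  ∃ (f : EuclideanSpace ℝ (Fin m) → EuclideanSpace ℝ (Fin n)) (K : ℝ≥0)
    (B : Set (EuclideanSpace ℝ (Fin m))),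
    LipschitzWith K f ∧ Bornology.IsBounded B ∧ f '' B = E

/-- `E` is countably `m`-rectifiable: a countable union of `m`-rectifiable sets (the empty set is
`m`-rectifiable, so families indexed by `ℕ` account for all countable families). -/
def IsCountablyRectifiable {n : ℕ} (m : ℕ) (E : Set (EuclideanSpace ℝ (Fin n))) : Prop :=
  ∃ A : ℕ → Set (EuclideanSpace ℝ (Fin n)), (∀ i, IsRectifiable m (A i)) ∧ E = ⋃ i, A i

/-- `E` is countably `(ℋᵐ, m)`-rectifiable: some countably `m`-rectifiable set contains
`ℋᵐ`-almost all of `E`. -/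
def IsCountablyHausdorffRectifiable {n : ℕ} (m : ℕ) (E : Set (EuclideanSpace ℝ (Fin n))) : Prop :=
  ∃ A : Set (EuclideanSpace ℝ (Fin n)), IsCountablyRectifiable m A ∧ μH[(m : ℝ)] (E \ A) = 0

/-! ### Rectifiability in manifolds -/

/-- A subset `E` of a smooth `d`-manifold is countably `(ℋᵐ, m)`-rectifiable if its image in every
smooth chart is a countably `(ℋᵐ, m)`-rectifiable subset of `ℝᵈ`. -/
def IsCountablyHausdorffRectifiableIn (d : ℕ) {M : Type*} [TopologicalSpace M]
    [ChartedSpace (EuclideanSpace ℝ (Fin d)) M] (m : ℕ) (E : Set M) : Prop :=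
  ∀ e ∈ IsManifold.maximalAtlas (𝓡 d) ∞ M,
    IsCountablyHausdorffRectifiable m (e '' (E ∩ e.source))

/-! ### Semiconcave functions and superdifferentials -/

/-- The Hessians of the functions in `F` are uniformly bounded above: around every point there are
smooth coordinates and a constant `C` with `D²f ≤ C · I` near this point for all `f ∈ F`
simultaneously. (On a compact manifold finitely many constants suffice.) -/
def HessiansBoundedAbove (d : ℕ) {M : Type*} [TopologicalSpace M]
    [ChartedSpace (EuclideanSpace ℝ (Fin d)) M] (F : Set (M → ℝ)) : Prop :=
  ∀ x : M, ∃ e ∈ IsManifold.maximalAtlas (𝓡 d) ∞ M, x ∈ e.source ∧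
    ∃ C : ℝ, ∀ᶠ y in 𝓝 x, ∀ f ∈ F, ∀ v : EuclideanSpace ℝ (Fin d),
      fderiv ℝ (fderiv ℝ (f ∘ e.symm)) (e y) v v ≤ C * ‖v‖ ^ 2

/-- `φ ∈ SCL(M)`: `φ` is the pointwise infimum of a family of `C²` functions on `M` whose Hessians
are uniformly bounded above. -/
def IsSemiconcave (d : ℕ) {M : Type*} [TopologicalSpace M]
    [ChartedSpace (EuclideanSpace ℝ (Fin d)) M] (φ : M → ℝ) : Prop :=
  ∃ F : Set (M → ℝ), (∀ f ∈ F, ContMDiff (𝓡 d) 𝓘(ℝ, ℝ) 2 f) ∧ HessiansBoundedAbove d F ∧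
    ∀ x : M, IsGLB ((fun f : M → ℝ => f x) '' F) (φ x)

/-- The proximal superdifferential `D⁺φ(x) ⊆ T*ₓM`: the differentials at `x` of the `C²` functions
that touch `φ` from above at `x`. -/
def superdifferential (d : ℕ) {M : Type*} [TopologicalSpace M]
    [ChartedSpace (EuclideanSpace ℝ (Fin d)) M] (φ : M → ℝ) (x : M) :
    Set (TangentSpace (𝓡 d) x →L[ℝ] ℝ) :=
  {p | ∃ f : M → ℝ, ContMDiffAt (𝓡 d) 𝓘(ℝ, ℝ) 2 f x ∧ f x = φ x ∧
    (∀ᶠ y in 𝓝 x, φ y ≤ f y) ∧ HasMFDerivAt (𝓡 d) 𝓘(ℝ, ℝ) f x p}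

/-- The dimension of the convex set `D⁺φ(x)`, i.e. the dimension of its affine hull. -/
def superdifferentialDim (d : ℕ) {M : Type*} [TopologicalSpace M]
    [ChartedSpace (EuclideanSpace ℝ (Fin d)) M] (φ : M → ℝ) (x : M) : ℕ :=
  Module.finrank ℝ (affineSpan ℝ (superdifferential d φ x)).direction

/-- `Σ^{≥ k}(φ) = {x ∈ M | dim D⁺φ(x) ≥ k}`. -/
def sigmaGE (d : ℕ) {M : Type*} [TopologicalSpace M]
    [ChartedSpace (EuclideanSpace ℝ (Fin d)) M] (φ : M → ℝ) (k : ℕ) : Set M :=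
  {x | k ≤ superdifferentialDim d φ x}

/-- `Σ^k(φ) = {x ∈ M | dim D⁺φ(x) = k}`. -/
def sigmaEQ (d : ℕ) {M : Type*} [TopologicalSpace M]
    [ChartedSpace (EuclideanSpace ℝ (Fin d)) M] (φ : M → ℝ) (k : ℕ) : Set M :=
  {x | superdifferentialDim d φ x = k}

end

end SCL

/-!
The values of `(C + 1) • x - D⁺φ(x)` determine `x` through a Lipschitz map, because `C • x - D⁺φ(x)`
is monotone in semiconcave coordinates. If `D⁺φ(x)` contains a `k`-simplex, then these values meet
a member of a countable family of affine subspaces of codimension `k`. Hence `Σ^{≥ k}(φ)` is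
covered by countably many Lipschitz images of `ℝ^(d-k)`.
-/

/-! Adding the supergradient inequalities at two points (`le_of_mem_frechetSuperdifferential`) gives
`(p - q) (x - y) ≤ C * ‖x - y‖ ^ 2`. Hence, as in Minty's parametrization, `(C + 1) • x - D⁺φ(x)`
has a single-valued 1-Lipschitz inverse. At a point of `Σ^{≥ k}` its values contain a `k`-simplex,
which some member of a countable dense family of linear maps sends onto an open subset of `ℝᵏ`. That
subset contains a point of a countable dense set, so the simplex meets one of countably many fibres
of codimension `k` (`isLipschitzCovered_of_monotone`). Lipschitz transition maps and a countable
subcover carry this to any chart. The cover misses no point, so no null set has to be discarded. -/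

namespace SCL

/-! ### Lipschitz covers -/

/-- `E` is covered by countably many Lipschitz images of `ℝᵐ`. -/
def IsLipschitzCovered {X : Type*} [PseudoEMetricSpace X] (m : ℕ) (E : Set X) : Prop :=
  ∃ f : ℕ → EuclideanSpace ℝ (Fin m) → X, (∀ i, ∃ K, LipschitzWith K (f i)) ∧
    E ⊆ ⋃ i, Set.range (f i)

namespace IsLipschitzCovered

variable {X : Type*} [PseudoEMetricSpace X] {m : ℕ}

theorem mono {E E' : Set X} (h : IsLipschitzCovered m E) (hE : E' ⊆ E) :
    IsLipschitzCovered m E' :=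
  let ⟨f, hf, hEf⟩ := h
  ⟨f, hf, hE.trans hEf⟩

theorem range {f : EuclideanSpace ℝ (Fin m) → X} {K : ℝ≥0} (hf : LipschitzWith K f) :
    IsLipschitzCovered m (Set.range f) :=
  ⟨fun _ => f, fun _ => ⟨K, hf⟩, Set.subset_iUnion (fun _ : ℕ => Set.range f) 0⟩

theorem empty [Nonempty X] : IsLipschitzCovered m (∅ : Set X) :=
  (range (LipschitzWith.const (Classical.arbitrary X))).mono (Set.empty_subset _)

theorem iUnion [Nonempty X] {ι : Type*} [Countable ι] {E : ι → Set X}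
    (h : ∀ i, IsLipschitzCovered m (E i)) : IsLipschitzCovered m (⋃ i, E i) := by
  choose f hf hE using h
  cases isEmpty_or_nonempty ι
  · rw [Set.iUnion_of_empty]
    exact empty
  · obtain ⟨g, hg⟩ := exists_surjective_nat (ι × ℕ)
    refine ⟨fun n => f (g n).1 (g n).2, fun n => hf _ _, Set.iUnion_subset fun i x hx => ?_⟩
    obtain ⟨j, hj⟩ := Set.mem_iUnion.1 (hE i hx)
    obtain ⟨n, hn⟩ := hg (i, j)
    exact Set.mem_iUnion.2 ⟨n, by simpa only [hn] using hj⟩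

theorem image_of_lipschitzWith {Y : Type*} [PseudoEMetricSpace Y] {E : Set X}
    (h : IsLipschitzCovered m E) {g : X → Y} {K : ℝ≥0} (hg : LipschitzWith K g) :
    IsLipschitzCovered m (g '' E) := by
  obtain ⟨f, hf, hE⟩ := h
  refine ⟨fun i => g ∘ f i, fun i => ?_, ?_⟩
  · obtain ⟨K', hK'⟩ := hf i
    exact ⟨_, hg.comp hK'⟩
  · rintro _ ⟨x, hx, rfl⟩
    obtain ⟨i, w, rfl⟩ := Set.mem_iUnion.1 (hE hx)
    exact Set.mem_iUnion.2 ⟨i, w, rfl⟩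

end IsLipschitzCovered

/-- A finite-dimensional target lets `g` be extended from `E` to a Lipschitz map on all of `X`,
which can be composed with the covering maps. -/
theorem IsLipschitzCovered.image_of_lipschitzOnWith {X : Type*} [PseudoMetricSpace X] {Y : Type*}
    [NormedAddCommGroup Y] [NormedSpace ℝ Y] [FiniteDimensional ℝ Y] {m : ℕ} {E : Set X}
    (h : IsLipschitzCovered m E) {g : X → Y} {K : ℝ≥0} (hg : LipschitzOnWith K g E) :
    IsLipschitzCovered m (g '' E) := by
  obtain ⟨g', hg', heq⟩ := hg.extend_finite_dimension
  rw [heq.image_eq]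
  exact h.image_of_lipschitzWith hg'

theorem IsLipschitzCovered.isCountablyHausdorffRectifiable {n m : ℕ}
    {E : Set (EuclideanSpace ℝ (Fin n))} (h : IsLipschitzCovered m E) :
    IsCountablyHausdorffRectifiable m E := by
  obtain ⟨f, hf, hE⟩ := h
  -- Rectifiable pieces need bounded domains, so each covering map is restricted to balls of integer
  -- radius.
  refine ⟨⋃ i : ℕ, f i.unpair.1 '' Metric.ball 0 (i.unpair.2 : ℝ), ⟨_, fun i => ?_, rfl⟩, ?_⟩
  · obtain ⟨K, hK⟩ := hf i.unpair.1
    exact ⟨_, K, _, hK, Metric.isBounded_ball, rfl⟩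
  · rw [Set.sdiff_eq_empty.2 ?_]
    · exact MeasureTheory.measure_empty
    intro x hx
    obtain ⟨i, w, rfl⟩ := Set.mem_iUnion.1 (hE hx)
    obtain ⟨N, hN⟩ := exists_nat_gt ‖w‖
    refine Set.mem_iUnion.2 ⟨Nat.pair i N, ?_⟩
    rw [Nat.unpair_pair]
    exact ⟨w, by simpa using hN, rfl⟩

/-! ### Fibres and simplices -/

/-- The fibres of a surjective linear map onto `ℝᵏ` are Lipschitz images of `ℝ^(n-k)`. -/
theorem isLipschitzCovered_fiber {V : Type*} [NormedAddCommGroup V] [NormedSpace ℝ V]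
    [FiniteDimensional ℝ V] {k : ℕ} (L : V →L[ℝ] (Fin k → ℝ)) (hL : Function.Surjective L)
    (r : Fin k → ℝ) : IsLipschitzCovered (Module.finrank ℝ V - k) {z | L z = r} := by
  obtain ⟨z₀, hz₀⟩ := hL r
  have hdim : Module.finrank ℝ (LinearMap.ker L.toLinearMap) = Module.finrank ℝ V - k := by
    have h1 := L.toLinearMap.finrank_range_add_finrank_ker
    rw [LinearMap.range_eq_top.2 hL, finrank_top, Module.finrank_fin_fun] at h1
    omega
  let g : EuclideanSpace ℝ (Fin (Module.finrank ℝ V - k)) ≃L[ℝ] LinearMap.ker L.toLinearMap :=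
    ContinuousLinearEquiv.ofFinrankEq (by rw [finrank_euclideanSpace_fin, hdim])
  let G := (LinearMap.ker L.toLinearMap).subtypeL.comp g.toContinuousLinearMap
  refine (IsLipschitzCovered.range ((LipschitzWith.const z₀).add G.lipschitz)).mono fun z hz => ?_
  have hker : z - z₀ ∈ LinearMap.ker L.toLinearMap := by
    rw [LinearMap.mem_ker]
    change L (z - z₀) = 0
    rw [map_sub, hz₀, hz.out, sub_self]
  refine ⟨g.symm ⟨_, hker⟩, ?_⟩
  simp [G]

/-- The open standard simplex of dimension `k`, projected to its last `k` coordinates. -/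
def openSimplex (k : ℕ) : Set (Fin k → ℝ) := {t | (∀ i, 0 < t i) ∧ ∑ i, t i < 1}

theorem isOpen_openSimplex (k : ℕ) : IsOpen (openSimplex k) := by
  have h1 : IsOpen (⋂ i : Fin k, {t : Fin k → ℝ | 0 < t i}) :=
    isOpen_iInter_of_finite fun i => isOpen_lt continuous_const (continuous_apply i)
  have h2 : IsOpen {t : Fin k → ℝ | ∑ i, t i < 1} := isOpen_lt (by fun_prop) continuous_const
  convert h1.inter h2 using 1
  ext t
  simp [openSimplex]

theorem openSimplex_nonempty (k : ℕ) : (openSimplex k).Nonempty := by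
  refine ⟨fun _ => 1 / ((k : ℝ) + 1), fun _ => by positivity, ?_⟩
  rw [Finset.sum_const, Finset.card_univ, Fintype.card_fin, nsmul_eq_mul, mul_one_div,
    div_lt_one (by positivity)]
  linarith

/-- Some continuous linear map from a dense sequence restricts to an isomorphism along a given
injective linear map from `ℝᵏ`. -/
theorem exists_isUnit_comp_denseSeq {V : Type*} [NormedAddCommGroup V] [NormedSpace ℝ V]
    [FiniteDimensional ℝ V] {k : ℕ} (ι : (Fin k → ℝ) →L[ℝ] V) (hι : Function.Injective ι) :
    ∃ i, IsUnit ((TopologicalSpace.denseSeq (V →L[ℝ] (Fin k → ℝ)) i).comp ι) := by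
  have hopen : IsOpen {L : V →L[ℝ] (Fin k → ℝ) | IsUnit (L.comp ι)} :=
    Units.isOpen.preimage
      (f := fun L : V →L[ℝ] (Fin k → ℝ) => (L.comp ι : (Fin k → ℝ) →L[ℝ] (Fin k → ℝ)))
      (by fun_prop)
  have hne : {L : V →L[ℝ] (Fin k → ℝ) | IsUnit (L.comp ι)}.Nonempty := by
    obtain ⟨g, hg⟩ := ι.toLinearMap.exists_leftInverse_of_injective (LinearMap.ker_eq_bot.2 hι)
    refine ⟨g.toContinuousLinearMap, ?_⟩
    have : g.toContinuousLinearMap.comp ι = 1 := by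
      ext1 x
      exact LinearMap.congr_fun hg x
    rw [Set.mem_ofPred_eq, this]
    exact isUnit_one
  exact (TopologicalSpace.denseRange_denseSeq _).exists_mem_open hopen hne

/-! ### Monotone operators -/

/-- The points at which an operator, monotone up to a multiple of the identity, has values
containing a `k`-dimensional simplex form a set of dimension at most `n - k`. -/
theorem isLipschitzCovered_of_monotone {V : Type*} [NormedAddCommGroup V]
    [InnerProductSpace ℝ V] [FiniteDimensional ℝ V] {k : ℕ} (X : Set V)
    (S : V → Set (V →L[ℝ] ℝ)) (C : ℝ)
    (hmono : ∀ x ∈ X, ∀ y ∈ X, ∀ p ∈ S x, ∀ q ∈ S y, (p - q) (x - y) ≤ C * ‖x - y‖ ^ 2)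
    (hS : ∀ x ∈ X, ∃ (p : V →L[ℝ] ℝ) (v : Fin k → V →L[ℝ] ℝ), LinearIndependent ℝ v ∧
      ∀ t ∈ openSimplex k, p + ∑ i, t i • v i ∈ S x) :
    IsLipschitzCovered (Module.finrank ℝ V - k) X := by
  classical
  -- `C` restores monotonicity; the extra `1` makes the operator expand distances.
  let F : V → (V →L[ℝ] ℝ) → (V →L[ℝ] ℝ) := fun x p => (C + 1) • innerSL ℝ x - p
  have hF : ∀ x ∈ X, ∀ y ∈ X, ∀ p ∈ S x, ∀ q ∈ S y, ‖x - y‖ ≤ ‖F x p - F y q‖ := by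
    intro x hx y hy p hp q hq
    have h1 := hmono x hx y hy p hp q hq
    have h2 : (F x p - F y q) (x - y) = (C + 1) * ‖x - y‖ ^ 2 - (p - q) (x - y) := by
      rw [← real_inner_self_eq_norm_sq]
      simp only [F, sub_apply, smul_apply, innerSL_apply_apply, smul_eq_mul, inner_sub_left]
      ring
    have h3 : (F x p - F y q) (x - y) ≤ ‖F x p - F y q‖ * ‖x - y‖ :=
      (le_abs_self _).trans ((F x p - F y q).le_opNorm _)
    by_contra! hlt
    nlinarith [norm_nonneg (F x p - F y q)]
  let G : Set (V →L[ℝ] ℝ) := {z | ∃ x ∈ X, ∃ p ∈ S x, F x p = z}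
  -- The inverse of `F`; its default value `0` off `G` plays no role.
  let J : (V →L[ℝ] ℝ) → V := fun z => if h : z ∈ G then h.choose else 0
  have hJ : ∀ x ∈ X, ∀ p ∈ S x, J (F x p) = x := by
    intro x hx p hp
    have hz : F x p ∈ G := ⟨x, hx, p, hp, rfl⟩
    obtain ⟨h1, q, hq, h2⟩ := hz.choose_spec
    have h3 := hF _ h1 x hx q hq p hp
    rw [h2, sub_self, norm_zero] at h3
    simp only [J, dif_pos hz]
    exact sub_eq_zero.1 (norm_le_zero_iff.1 h3)
  have hLip : LipschitzOnWith 1 J G := by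
    refine LipschitzOnWith.of_dist_le_mul ?_
    rintro _ ⟨x, hx, p, hp, rfl⟩ _ ⟨y, hy, q, hq, rfl⟩
    rw [hJ x hx p hp, hJ y hy q hq, dist_eq_norm, dist_eq_norm, NNReal.coe_one, one_mul]
    exact hF x hx y hy p hp q hq
  have hdim : Module.finrank ℝ (V →L[ℝ] ℝ) = Module.finrank ℝ V :=
    (InnerProductSpace.toDual ℝ V).toLinearEquiv.finrank_eq.symm
  let L := TopologicalSpace.denseSeq ((V →L[ℝ] ℝ) →L[ℝ] (Fin k → ℝ))
  let r := TopologicalSpace.denseSeq (Fin k → ℝ)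
  have hcov : IsLipschitzCovered (Module.finrank ℝ V - k)
      (⋃ ij : {i // Function.Surjective (L i)} × ℕ, J '' ({z | L ij.1 z = r ij.2} ∩ G)) := by
    refine IsLipschitzCovered.iUnion fun ij => ?_
    have := isLipschitzCovered_fiber (L ij.1) ij.1.2 (r ij.2)
    rw [hdim] at this
    exact (this.mono Set.inter_subset_left).image_of_lipschitzOnWith
      (hLip.mono Set.inter_subset_right)
  refine hcov.mono fun x hx => ?_
  obtain ⟨p, v, hv, hpv⟩ := hS x hx
  let ι : (Fin k → ℝ) →L[ℝ] (V →L[ℝ] ℝ) := (Fintype.linearCombination ℝ v).toContinuousLinearMap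
  have hιv : ∀ t, ι t = ∑ i, t i • v i := fun t => Fintype.linearCombination_apply ℝ v t
  have hι : Function.Injective ι := hv.fintypeLinearCombination_injective
  obtain ⟨i, hi⟩ := exists_isUnit_comp_denseSeq ι hι
  have hsurj : Function.Surjective ((L i).comp ι) :=
    (ContinuousLinearMap.isUnit_iff_bijective.1 hi).2
  -- This is the image under `L i` of the simplex of values at `x`. It is open, so it contains some
  -- `r j`.
  have himg : IsOpen ((fun t => L i (F x p) - ((L i).comp ι) t) '' openSimplex k) := by
    have h1 : IsOpenMap ((L i).comp ι) := ContinuousLinearMap.isOpenMap _ hsurj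
    exact ((Homeomorph.subLeft (L i (F x p))).isOpenMap.comp h1) _ (isOpen_openSimplex k)
  obtain ⟨j, t, ht, hrt⟩ := (TopologicalSpace.denseRange_denseSeq _).exists_mem_open himg
    ((openSimplex_nonempty k).image _)
  have hmem : p + ι t ∈ S x := by
    rw [hιv]
    exact hpv t ht
  refine Set.mem_iUnion.2 ⟨(⟨i, Function.Surjective.of_comp hsurj⟩, j),
    F x (p + ι t), ⟨?_, x, hx, _, hmem, rfl⟩, hJ x hx _ hmem⟩
  rw [Set.mem_ofPred_eq]
  refine Eq.trans ?_ hrt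
  change L i (F x (p + ι t)) = L i (F x p) - L i (ι t)
  rw [← map_sub]
  congr 1
  simp only [F]
  abel

/-! ### Semiconcavity and supergradients -/

theorem hasDerivAt_comp_line {V W : Type*} [NormedAddCommGroup V] [NormedSpace ℝ V]
    [NormedAddCommGroup W] [NormedSpace ℝ W] {f : V → W} {a v : V} {s : ℝ} {f' : V →L[ℝ] W}
    (hf : HasFDerivAt f f' (a + s • v)) : HasDerivAt (fun s : ℝ => f (a + s • v)) (f' v) s := by
  have h : HasDerivAt (fun s : ℝ => a + s • v) v s := by
    simpa using ((hasDerivAt_id s).smul_const v).const_add a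
  exact hf.comp_hasDerivAt s h

/-- A `C²` function with Hessian bounded above by `C` on an open convex set is concave there up to
the quadratic error `C / 2 * t * (1 - t) * ‖b - a‖ ^ 2`. -/
theorem le_of_fderiv_fderiv_le {V : Type*} [NormedAddCommGroup V] [NormedSpace ℝ V] {f : V → ℝ}
    {B : Set V} (hBo : IsOpen B) (hB : Convex ℝ B) (hf : ContDiffOn ℝ 2 f B) {C : ℝ}
    (hC : ∀ y ∈ B, ∀ v, fderiv ℝ (fderiv ℝ f) y v v ≤ C * ‖v‖ ^ 2) {a b : V} (ha : a ∈ B)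
    (hb : b ∈ B) {t : ℝ} (ht0 : 0 ≤ t) (ht1 : t ≤ 1) :
    (1 - t) * f a + t * f b ≤ f (a + t • (b - a)) + C / 2 * (t * (1 - t)) * ‖b - a‖ ^ 2 := by
  have hmem : ∀ s ∈ Set.Icc (0 : ℝ) 1, a + s • (b - a) ∈ B := fun s hs =>
    hB.add_smul_sub_mem ha hb hs
  have hd1 : ∀ s ∈ Set.Icc (0 : ℝ) 1, HasDerivAt (fun s : ℝ => f (a + s • (b - a)))
      (fderiv ℝ f (a + s • (b - a)) (b - a)) s := fun s hs =>
    hasDerivAt_comp_line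
      ((hf.contDiffAt (hBo.mem_nhds (hmem s hs))).differentiableAt two_ne_zero).hasFDerivAt
  have hd2 : ∀ s ∈ Set.Icc (0 : ℝ) 1, HasDerivAt
      (fun s : ℝ => fderiv ℝ f (a + s • (b - a)) (b - a))
      (fderiv ℝ (fderiv ℝ f) (a + s • (b - a)) (b - a) (b - a)) s := fun s hs => by
    have h1 : DifferentiableAt ℝ (fderiv ℝ f) (a + s • (b - a)) :=
      ((hf.contDiffAt (hBo.mem_nhds (hmem s hs))).fderiv_right (m := 1)
        (by norm_num)).differentiableAt one_ne_zero
    exact hasDerivAt_comp_line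
      (h1.hasFDerivAt.clm_apply (hasFDerivAt_const (b - a) _)) |>.congr_deriv (by simp [-map_sub])
  -- The quadratic term absorbs the Hessian bound; comparing it at `0`, `t`, `1` leaves the error `t
  -- * (1 - t)`.
  have hconc : ConcaveOn ℝ (Set.Icc (0 : ℝ) 1)
      (fun s : ℝ => f (a + s • (b - a)) - C / 2 * ‖b - a‖ ^ 2 * s ^ 2) := by
    refine concaveOn_of_hasDerivWithinAt2_nonpos (convex_Icc 0 1)
      (f' := fun s => fderiv ℝ f (a + s • (b - a)) (b - a) - C * ‖b - a‖ ^ 2 * s)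
      (f'' := fun s => fderiv ℝ (fderiv ℝ f) (a + s • (b - a)) (b - a) (b - a)
        - C * ‖b - a‖ ^ 2) ?_ ?_ ?_ ?_
    · exact fun s hs => ((hd1 s hs).continuousAt.sub (by fun_prop)).continuousWithinAt
    · intro s hs
      exact (((hd1 s (interior_subset hs)).sub ((hasDerivAt_pow 2 s).const_mul
        (C / 2 * ‖b - a‖ ^ 2))).congr_deriv (by push_cast; ring)).hasDerivWithinAt
    · intro s hs
      exact (((hd2 s (interior_subset hs)).sub ((hasDerivAt_id s).const_mul
        (C * ‖b - a‖ ^ 2))).congr_deriv (by ring)).hasDerivWithinAt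
    · exact fun s hs => sub_nonpos.2 (hC _ (hmem s (interior_subset hs)) _)
  have key := hconc.2 (Set.left_mem_Icc.2 zero_le_one) (Set.right_mem_Icc.2 zero_le_one)
    (sub_nonneg.2 ht1) ht0 (sub_add_cancel 1 t)
  simp only [smul_eq_mul, mul_zero, mul_one, zero_add, zero_smul, one_smul, add_zero,
    add_sub_cancel] at key
  linarith

/-- The Fréchet superdifferential of a function on a normed space. -/
def frechetSuperdifferential {V : Type*} [NormedAddCommGroup V] [NormedSpace ℝ V] (ψ : V → ℝ)
    (x : V) : Set (V →L[ℝ] ℝ) :=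
  {p | ∃ g : V → ℝ, HasFDerivAt g p x ∧ g x = ψ x ∧ ∀ᶠ y in 𝓝 x, ψ y ≤ g y}

theorem convex_frechetSuperdifferential {V : Type*} [NormedAddCommGroup V] [NormedSpace ℝ V]
    (ψ : V → ℝ) (x : V) : Convex ℝ (frechetSuperdifferential ψ x) := by
  rintro p ⟨f, hf, hfx, hfψ⟩ q ⟨g, hg, hgx, hgψ⟩ a b ha hb hab
  refine ⟨a • f + b • g, (hf.const_smul a).add (hg.const_smul b), ?_, ?_⟩
  · simp only [Pi.add_apply, Pi.smul_apply, hfx, hgx, ← add_smul, hab, one_smul]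
  · filter_upwards [hfψ, hgψ] with y hfy hgy
    calc ψ y = a * ψ y + b * ψ y := by rw [← add_mul, hab, one_mul]
      _ ≤ a * f y + b * g y := by gcongr

/-- Elements of the superdifferential of a semiconcave function are global supergradients. -/
theorem le_of_mem_frechetSuperdifferential {V : Type*} [NormedAddCommGroup V] [NormedSpace ℝ V]
    {ψ : V → ℝ} {C : ℝ} {a b : V}
    (hψ : ∀ t : ℝ, 0 ≤ t → t ≤ 1 →
      (1 - t) * ψ a + t * ψ b ≤ ψ (a + t • (b - a)) + C / 2 * (t * (1 - t)) * ‖b - a‖ ^ 2)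
    {p : V →L[ℝ] ℝ} (hp : p ∈ frechetSuperdifferential ψ a) :
    ψ b ≤ ψ a + p (b - a) + C / 2 * ‖b - a‖ ^ 2 := by
  obtain ⟨g, hg, hga, hgψ⟩ := hp
  have ha0 : a + (0 : ℝ) • (b - a) = a := by simp
  have hder : HasDerivAt (fun s : ℝ => g (a + s • (b - a))) (p (b - a)) 0 :=
    hasDerivAt_comp_line (by rwa [ha0])
  have hlim := hder.tendsto_slope_zero_right
  have hlim2 : Filter.Tendsto (fun t : ℝ => C / 2 * (1 - t) * ‖b - a‖ ^ 2) (𝓝[>] 0)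
      (𝓝 (C / 2 * (1 - 0) * ‖b - a‖ ^ 2)) :=
    ((by fun_prop : Continuous fun t : ℝ => C / 2 * (1 - t) * ‖b - a‖ ^ 2).tendsto
      0).mono_left nhdsWithin_le_nhds
  have hev : ∀ᶠ t : ℝ in 𝓝[>] 0, ψ (a + t • (b - a)) ≤ g (a + t • (b - a)) := by
    have h1 : Filter.Tendsto (fun s : ℝ => a + s • (b - a)) (𝓝 0) (𝓝 a) := by
      have h2 : Continuous fun s : ℝ => a + s • (b - a) := by fun_prop
      simpa using h2.tendsto 0
    exact (h1.eventually hgψ).filter_mono nhdsWithin_le_nhds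
  -- Replace `ψ` by `g` along the segment, subtract `ψ a = g a`, divide by `t` and let `t → 0⁺`.
  have hle : ψ b - ψ a ≤ p (b - a) + C / 2 * (1 - 0) * ‖b - a‖ ^ 2 := by
    refine ge_of_tendsto (hlim.add hlim2) ?_
    filter_upwards [hev, Ioc_mem_nhdsGT (zero_lt_one (α := ℝ))] with t ht ht01
    have h1 := hψ t ht01.1.le ht01.2
    rw [zero_add, ha0, hga, smul_eq_mul, ← sub_le_iff_le_add, inv_mul_eq_div,
      le_div_iff₀ ht01.1]
    nlinarith
  linarith

/-! ### Simplices in convex sets -/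

/-- For `k ≠ 0`, a set of vectors whose affine span has dimension at least `k` contains `k + 1`
affinely independent points. -/
theorem exists_linearIndependent_sub {W : Type*} [AddCommGroup W] [Module ℝ W] {s : Set W} {k : ℕ}
    (hk : k ≠ 0) (h : k ≤ Module.finrank ℝ (affineSpan ℝ s).direction) :
    ∃ p ∈ s, ∃ q : Fin k → W, (∀ i, q i ∈ s) ∧ LinearIndependent ℝ fun i => q i - p := by
  obtain rfl | ⟨p, hp⟩ := s.eq_empty_or_nonempty
  · rw [AffineSubspace.span_empty, AffineSubspace.direction_bot, finrank_bot] at h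
    omega
  rw [direction_affineSpan, vectorSpan_eq_span_vsub_set_right ℝ hp] at h
  -- `finrank` is `0` in infinite dimension, so `k ≠ 0` forces finiteness.
  have : Module.Finite ℝ (Submodule.span ℝ ((· -ᵥ p) '' s)) :=
    Module.finite_of_finrank_pos (by omega)
  obtain ⟨f, hf, -, hli⟩ := Submodule.exists_fun_fin_finrank_span_eq ℝ ((· -ᵥ p) '' s)
  choose g hg hgf using hf
  refine ⟨p, hp, fun i => g (Fin.castLE h i), fun i => hg _, ?_⟩
  have heq : (fun i => g (Fin.castLE h i) - p) = f ∘ Fin.castLE h := funext fun i => hgf _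
  rw [heq]
  exact hli.comp _ (Fin.castLE_injective h)

/-- The point is the convex combination with weight `1 - ∑ i, t i` at `p` and `t i` at `q i`. -/
theorem _root_.Convex.add_sum_smul_sub_mem {W : Type*} [AddCommGroup W] [Module ℝ W] {s : Set W}
    (hs : Convex ℝ s) {k : ℕ} {p : W} (hp : p ∈ s) {q : Fin k → W} (hq : ∀ i, q i ∈ s)
    {t : Fin k → ℝ} (ht : t ∈ openSimplex k) : p + ∑ i, t i • (q i - p) ∈ s := by
  have h := hs.sum_mem (t := Finset.univ) (w := Fin.cons (1 - ∑ i, t i) t)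
    (z := (Fin.cons p q : Fin (k + 1) → W)) ?_ ?_ ?_
  · rw [Fin.sum_univ_succ] at h
    convert h using 1
    simp only [Fin.cons_zero, Fin.cons_succ, smul_sub, Finset.sum_sub_distrib, sub_smul, one_smul,
      Finset.sum_smul]
    abel
  · intro i _
    refine Fin.cases ?_ (fun j => ?_) i
    · simpa using ht.2.le
    · simpa using (ht.1 j).le
  · simp [Fin.sum_univ_succ]
  · intro i _
    refine Fin.cases ?_ (fun j => ?_) i
    · simpa using hp
    · simpa using hq j

/-! ### Passage to charts -/

variable {d : ℕ} {M : Type*} [TopologicalSpace M] [ChartedSpace (EuclideanSpace ℝ (Fin d)) M]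

theorem mdifferentiable_of_mem_maximalAtlas
    {e : OpenPartialHomeomorph M (EuclideanSpace ℝ (Fin d))}
    (he : e ∈ IsManifold.maximalAtlas (𝓡 d) ∞ M) : e.MDifferentiable (𝓡 d) (𝓡 d) :=
  ⟨(contMDiffOn_of_mem_maximalAtlas he).mdifferentiableOn (by simp),
    (contMDiffOn_symm_of_mem_maximalAtlas he).mdifferentiableOn (by simp)⟩

/-- Only first-order contact is kept: the supergradient inequality does not need the test function
to be `C²`. -/
theorem comp_mem_frechetSuperdifferential {φ : M → ℝ}
    {e : OpenPartialHomeomorph M (EuclideanSpace ℝ (Fin d))}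
    (he : e ∈ IsManifold.maximalAtlas (𝓡 d) ∞ M) {y : EuclideanSpace ℝ (Fin d)}
    (hy : y ∈ e.target) {p : TangentSpace (𝓡 d) (e.symm y) →L[ℝ] ℝ}
    (hp : p ∈ superdifferential d φ (e.symm y)) :
    p.comp (mfderiv (𝓡 d) (𝓡 d) e.symm y) ∈ frechetSuperdifferential (φ ∘ e.symm) y := by
  obtain ⟨f, -, hfx, hfφ, hfp⟩ := hp
  refine ⟨f ∘ e.symm, ?_, hfx, (e.symm.continuousAt hy).eventually hfφ⟩
  have h := HasMFDerivAt.comp y hfp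
    ((mdifferentiable_of_mem_maximalAtlas he).mdifferentiableAt_symm hy).hasMFDerivAt
  exact h.hasFDerivAt

/-- In a chart, the superdifferential at a point of `Σ^{≥ k}` contains a `k`-simplex. -/
theorem exists_simplex_subset_frechetSuperdifferential {φ : M → ℝ} {k : ℕ} (hk : k ≠ 0)
    {e : OpenPartialHomeomorph M (EuclideanSpace ℝ (Fin d))}
    (he : e ∈ IsManifold.maximalAtlas (𝓡 d) ∞ M) {y : EuclideanSpace ℝ (Fin d)}
    (hy : y ∈ e.target) (hsig : e.symm y ∈ sigmaGE d φ k) :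
    ∃ (p : EuclideanSpace ℝ (Fin d) →L[ℝ] ℝ) (v : Fin k → EuclideanSpace ℝ (Fin d) →L[ℝ] ℝ),
      LinearIndependent ℝ v ∧
      ∀ t ∈ openSimplex k, p + ∑ i, t i • v i ∈ frechetSuperdifferential (φ ∘ e.symm) y := by
  obtain ⟨p, hp, q, hq, hli⟩ := exists_linearIndependent_sub hk hsig
  let A := mfderiv (𝓡 d) (𝓡 d) e.symm y
  have hA : Function.Surjective A :=
    (mdifferentiable_of_mem_maximalAtlas he).symm.mfderiv_surjective hy
  let R : (TangentSpace (𝓡 d) (e.symm y) →L[ℝ] ℝ) →ₗ[ℝ] (EuclideanSpace ℝ (Fin d) →L[ℝ] ℝ) :=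
    { toFun := fun p => p.comp A
      map_add' := fun _ _ => rfl
      map_smul' := fun _ _ => rfl }
  -- Precomposition with a surjective derivative is injective, so independence survives in the
  -- chart.
  have hR : LinearMap.ker R = ⊥ := by
    rw [LinearMap.ker_eq_bot]
    intro p₁ p₂ h
    ext1 w
    obtain ⟨u, rfl⟩ := hA w
    exact DFunLike.congr_fun h u
  refine ⟨R p, fun i => R (q i) - R p, ?_, fun t ht => ?_⟩
  · have heq : (fun i => R (q i) - R p) = R ∘ fun i => q i - p :=
      funext fun i => (map_sub R _ _).symm
    rw [heq]
    exact hli.map' R hR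
  · exact (convex_frechetSuperdifferential _ y).add_sum_smul_sub_mem
      (comp_mem_frechetSuperdifferential he hy hp)
      (fun i => comp_mem_frechetSuperdifferential he hy (hq i)) ht

/-- An infimum of `C²` functions with Hessians bounded above by `C` on an open convex set of
coordinates is semiconcave in these coordinates. -/
theorem semiconcave_chart_of_isGLB {φ : M → ℝ} {F : Set (M → ℝ)}
    (hF : ∀ f ∈ F, ContMDiff (𝓡 d) 𝓘(ℝ, ℝ) 2 f)
    (hφ : ∀ x : M, IsGLB ((fun f : M → ℝ => f x) '' F) (φ x))
    {e : OpenPartialHomeomorph M (EuclideanSpace ℝ (Fin d))}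
    (he : e ∈ IsManifold.maximalAtlas (𝓡 d) ∞ M) {B : Set (EuclideanSpace ℝ (Fin d))}
    (hBo : IsOpen B) (hB : Convex ℝ B) (hBe : B ⊆ e.target) {C : ℝ}
    (hC : ∀ y ∈ B, ∀ f ∈ F, ∀ v, fderiv ℝ (fderiv ℝ (f ∘ e.symm)) y v v ≤ C * ‖v‖ ^ 2)
    {a b : EuclideanSpace ℝ (Fin d)} (ha : a ∈ B) (hb : b ∈ B) {t : ℝ} (ht0 : 0 ≤ t)
    (ht1 : t ≤ 1) :
    (1 - t) * (φ ∘ e.symm) a + t * (φ ∘ e.symm) b ≤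
      (φ ∘ e.symm) (a + t • (b - a)) + C / 2 * (t * (1 - t)) * ‖b - a‖ ^ 2 := by
  rw [← sub_le_iff_le_add]
  -- It suffices to bound by each `f`, since `φ ≤ f` at both endpoints.
  refine (hφ _).2 ?_
  rintro _ ⟨f, hf, rfl⟩
  rw [sub_le_iff_le_add]
  have hfe : ContDiffOn ℝ 2 (f ∘ e.symm) B := by
    have h1 : ContMDiffOn (𝓡 d) (𝓡 d) 2 e.symm e.target :=
      (contMDiffOn_symm_of_mem_maximalAtlas he).of_le ENat.LEInfty.out
    exact ((hF f hf).comp_contMDiffOn (h1.mono hBe)).contDiffOn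
  refine le_trans ?_ (le_of_fderiv_fderiv_le hBo hB hfe (fun y hy => hC y hy f hf) ha hb ht0 ht1)
  have h1 : φ (e.symm a) ≤ f (e.symm a) := (hφ _).1 ⟨f, hf, rfl⟩
  have h2 : φ (e.symm b) ≤ f (e.symm b) := (hφ _).1 ⟨f, hf, rfl⟩
  exact add_le_add (mul_le_mul_of_nonneg_left h1 (sub_nonneg.2 ht1))
    (mul_le_mul_of_nonneg_left h2 ht0)

/-! ### Local and global covers -/

/-- Locally, the image of `Σ^{≥ k}` in a chart is covered by Lipschitz images of `ℝ^(d-k)`. -/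
theorem IsSemiconcave.exists_nhds_isLipschitzCovered {φ : M → ℝ} (hφ : IsSemiconcave d φ)
    {k : ℕ} (hk : k ≠ 0) {e : OpenPartialHomeomorph M (EuclideanSpace ℝ (Fin d))}
    (he : e ∈ IsManifold.maximalAtlas (𝓡 d) ∞ M) {x : M} (hx : x ∈ e.source) :
    ∃ O ∈ 𝓝 x, IsLipschitzCovered (d - k) (e '' (sigmaGE d φ k ∩ O)) := by
  obtain ⟨F, hF, hH, hglb⟩ := hφ
  -- The Hessian bound lives in `e'`, not in the given `e`; the cover is built in `e'` and moved by
  -- the locally Lipschitz transition map.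
  obtain ⟨e', he', hxe', C, hC⟩ := hH x
  have hex : e' x ∈ e'.target := e'.map_source hxe'
  have hsymm : e'.symm (e' x) = x := e'.left_inv hxe'
  have htrans : ContDiffAt ℝ 1 (e ∘ e'.symm) (e' x) := by
    have h1 : ContMDiffAt (𝓡 d) (𝓡 d) 1 e'.symm (e' x) :=
      (contMDiffAt_symm_of_mem_maximalAtlas he' hex).of_le (by exact_mod_cast le_top)
    have h2 : ContMDiffAt (𝓡 d) (𝓡 d) 1 e (e'.symm (e' x)) :=
      (contMDiffAt_of_mem_maximalAtlas he (by rwa [hsymm])).of_le (by exact_mod_cast le_top)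
    exact (h2.comp _ h1).contDiffAt
  obtain ⟨K, T, hT, hLip⟩ := htrans.exists_lipschitzOnWith
  have hC' : ∀ᶠ y in 𝓝 (e' x), ∀ f ∈ F, ∀ v,
      fderiv ℝ (fderiv ℝ (f ∘ e'.symm)) y v v ≤ C * ‖v‖ ^ 2 := by
    have h1 : Filter.Tendsto e'.symm (𝓝 (e' x)) (𝓝 x) := by
      simpa only [hsymm] using (e'.symm.continuousAt hex).tendsto
    filter_upwards [h1.eventually hC, e'.open_target.mem_nhds hex] with y hy hyt
    rwa [e'.right_inv hyt] at hy
  obtain ⟨r, hr, hball⟩ := Metric.mem_nhds_iff.1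
    (Filter.inter_mem (Filter.inter_mem hT (e'.open_target.mem_nhds hex)) hC')
  set B := Metric.ball (e' x) r
  let X := {y ∈ B | e'.symm y ∈ sigmaGE d φ k}
  have hsemi := fun {a b : EuclideanSpace ℝ (Fin d)} (ha : a ∈ B) (hb : b ∈ B) =>
    fun p hp => le_of_mem_frechetSuperdifferential (p := p) (fun (t : ℝ) (ht0 : 0 ≤ t) ht1 =>
    semiconcave_chart_of_isGLB hF hglb he' Metric.isOpen_ball (convex_ball _ _)
      (fun y hy => (hball hy).1.2) (fun y hy => (hball hy).2) ha hb ht0 ht1) hp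
  have hX : IsLipschitzCovered (d - k) X := by
    have h := isLipschitzCovered_of_monotone (k := k) X
      (frechetSuperdifferential (φ ∘ e'.symm)) C ?_ ?_
    · rwa [finrank_euclideanSpace_fin] at h
    · intro a ha b hb p hp q hq
      have h1 := hsemi ha.1 hb.1 p hp
      have h2 := hsemi hb.1 ha.1 q hq
      rw [← neg_sub a b, map_neg, norm_neg] at h1
      rw [sub_apply]
      linarith
    · exact fun y hy =>
        exists_simplex_subset_frechetSuperdifferential hk he' (hball hy.1).1.2 hy.2
  refine ⟨e'.source ∩ e' ⁻¹' B, Filter.inter_mem (e'.open_source.mem_nhds hxe')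
    ((e'.continuousAt hxe').preimage_mem_nhds (Metric.ball_mem_nhds _ hr)), ?_⟩
  refine (hX.image_of_lipschitzOnWith (hLip.mono fun y hy => (hball hy.1).1.1)).mono ?_
  rintro _ ⟨z, ⟨hz, hzs, hzB⟩, rfl⟩
  refine ⟨e' z, ⟨hzB, ?_⟩, ?_⟩
  · rwa [e'.left_inv hzs]
  · rw [Function.comp_apply, e'.left_inv hzs]

theorem IsSemiconcave.isLipschitzCovered_sigmaGE [SecondCountableTopology M] {φ : M → ℝ}
    (hφ : IsSemiconcave d φ) (k : ℕ) {e : OpenPartialHomeomorph M (EuclideanSpace ℝ (Fin d))}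
    (he : e ∈ IsManifold.maximalAtlas (𝓡 d) ∞ M) :
    IsLipschitzCovered (d - k) (e '' (sigmaGE d φ k ∩ e.source)) := by
  obtain rfl | hk := eq_or_ne k 0
  · exact (IsLipschitzCovered.range (LipschitzWith.id)).mono fun y _ => ⟨y, rfl⟩
  choose! O hO hcov using fun x (hx : x ∈ e.source) =>
    hφ.exists_nhds_isLipschitzCovered hk he hx
  -- Lindelöf: countably many of the local neighbourhoods suffice.
  obtain ⟨t, hts, htc, ht⟩ := TopologicalSpace.countable_cover_nhdsWithin
    fun x hx => nhdsWithin_le_nhds (s := e.source) (hO x hx)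
  have := htc.to_subtype
  refine (IsLipschitzCovered.iUnion fun x : t => hcov x (hts x.2)).mono ?_
  rintro _ ⟨z, ⟨hz, hzs⟩, rfl⟩
  obtain ⟨x, hxt, hzx⟩ := Set.mem_iUnion₂.1 (ht hzs)
  exact Set.mem_iUnion.2 ⟨⟨x, hxt⟩, z, ⟨hz, hzx⟩, rfl⟩

end SCL

theorem mainTheorem4 {d : ℕ} {M : Type*} [TopologicalSpace M] [T2Space M] [CompactSpace M]
    [ConnectedSpace M] [ChartedSpace (EuclideanSpace ℝ (Fin d)) M] [IsManifold (𝓡 d) ∞ M]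
    (φ : M → ℝ) (hφ : SCL.IsSemiconcave d φ) (k : ℕ) (hk : k ≤ d) :
    SCL.IsCountablyHausdorffRectifiableIn d (d - k) (SCL.sigmaGE d φ k) ∧
      SCL.IsCountablyHausdorffRectifiableIn d (d - k) (SCL.sigmaEQ d φ k) := by
  have : SecondCountableTopology M :=
    ChartedSpace.secondCountable_of_sigmaCompact (EuclideanSpace ℝ (Fin d)) M
  have hcov := fun e he => hφ.isLipschitzCovered_sigmaGE k (e := e) he
  refine ⟨fun e he => (hcov e he).isCountablyHausdorffRectifiable,
    fun e he => ((hcov e he).mono ?_).isCountablyHausdorffRectifiable⟩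
  exact Set.image_mono (Set.inter_subset_inter_left _ fun x hx => hx.ge)
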